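/- Let $V$ (variables) and $A$ (actions) be sets with $V$ infinite and $|A|\le|V|$, and let $\Sigma$ be a signature: a set of function symbols $f$ with $|\Sigma|\le|V|$, each with an arity $ar(f)\in\mathbb N$. Terms are built from $V$ and $\Sigma$; a term or literal is closed if it contains no variables. A literal is an expression $t\xrightarrow{a}t'$ (positive) or $t\stackrel{a}{\nrightarrow}$ (negative), with $t,t'$ terms and $a\in A$; these two literals deny each other. A transition rule $\frac{H}{\alpha}$ consists of a set $H$ of literals (premises) and a literal $\alpha$ (conclusion), whose left- and right-hand sides are the source and target of the rule. A transition system specification (TSS) $P$ over $\Sigma$ is a set of transition rules; it is standard if all conclusions are positive, and positive if moreover all premises are positive. **Provability.** For a set $K$ of literals, $P\vdash\frac{K}{\alpha}$ means that there is a well-founded tree labelled by literals with root label $\alpha$ such that, if $\beta$ is the label of a node, either this node is a leaf with $\beta\in K$, or $\frac{K'}{\beta}$ is a substitution instance of a rule of $P$, where $K'$ is the set of labels of the nodes directly above it. A closed literal $\alpha$ is $ws$-provable, $P\vdash_{ws}\alpha$, if there is a well-founded tree labelled by closed literals with root label $\alpha$ such that, for each node with label $\beta$ and with $K'$ the set of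 labels of the nodes directly above it, either $\frac{K'}{\beta}$ is a closed substitution instance of a rule of $P$, or $\beta$ is negative and for every set $N$ of closed negative literals with $P\vdash\frac{N}{\gamma}$ for some closed $\gamma$ denying $\beta$, a literal in $K'$ denies one in $N$. **Partial trace preorder.** Partial trace observations are given by $\varphi::=\top\mid a\varphi$ with $a\in A$. For closed terms $p$, always $p\models_P\top$, and $p\models_P a\varphi$ iff $P\vdash_{ws}p\xrightarrow{a}q$ and $q\models_P\varphi$ for some closed term $q$. The partial trace preorder induced by $P$ is: $p\sqsubseteq_T^P q$ iff every partial trace observation satisfied by $p$ is satisfied by $q$. **Format.** An ntytt rule is a rule in which the right-hand sides of positive premises are variables that are all distinct and do not occur in the source. It is an ntyxt rule if its source is a variable, and an ntyft rule if its source contains exactly one function symbol and no multiple occurrences of variables. A rule has no lookahead if no variable in the right-hand side of a positive premise occurs in the left-hand side of a premise. An occurrence of a variable in an ntytt rule is propagated if it is in the target, or in the left-hand side of a positive premise whose right-hand side occurs in the target; it is polled if it is in the left-hand side of a premise that does not have a right-hand side occurring in the target. Let $\Lambda$ be a predicate on the pairs $(f,i)$ with $f\in\Sigma$, $1\le i\le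 ar(f)$. An occurrence of $x$ in a term $t$ is at a $\Lambda$-liquid position if $t=x$, or $t=f(t_1,\dots,t_{ar(f)})$ and for some $i$ with $\Lambda(f,i)$ the occurrence is in $t_i$, at a $\Lambda$-liquid position of $t_i$. A variable of an ntytt rule is $\Lambda$-floating if it is the right-hand side of a positive premise, or it occurs exactly once in the source, at a $\Lambda$-liquid position. A standard ntytt rule is $\Lambda$-failure trace safe if it has no lookahead and each $\Lambda$-floating variable 1. has at most one propagated occurrence, which must be at a $\Lambda$-liquid position (of the target, or of the left-hand side of the premise containing it); 2. does not have both propagated and polled occurrences; 3. has at most one polled occurrence, which must be at a $\Lambda$-liquid position in (the left-hand side of) a positive premise. A standard TSS is in failure trace format if all its rules are ntyft or ntyxt rules and, for some $\Lambda$, all its rules are $\Lambda$-failure trace safe. A TSS is in partial trace format if it is positive and in failure trace format. **Theorem.** If a TSS $P$ over $\Sigma$ is in partial trace format, then the partial trace preorder that it induces is a precongruence: $\sqsubseteq_T^P$ is a preorder on the closed terms, and for all $f\in\Sigma$ and closed terms $p_i,q_i$ with $p_i\sqsubseteq_T^P q_i$ for $i=1,\dots,ar(f)$, $$f(p_1,\dots,p_{ar(f)})\sqsubseteq_T^P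 f(q_1,\dots,q_{ar(f)}).$$ -/

import Mathlib

universe u v w

namespace SOS

/-- A signature: a collection of function symbols with arities. -/
structure Signature where
  /-- the function symbols -/
  Sym : Type u
  /-- the arity function -/
  ar : Sym → ℕ

/-- Terms over the signature `S` with variables from `V`. -/
inductive Term (S : Signature.{u}) (V : Type v) : Type (max u v)
  | var (x : V) : Term S V
  | app (f : S.Sym) (ts : Fin (S.ar f) → Term S V) : Term S V

variable {S : Signature.{u}} {V : Type v} {A : Type w}

namespace Term

/-- The set of variables that occur in a term. -/
def vars : Term S V → Set V
  | var x => {x}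
  | app _ ts => ⋃ i, (ts i).vars

/-- Application of a substitution. A partial substitution is represented by the total
one that fixes the variables outside its domain. -/
def subst (σ : V → Term S V) : Term S V → Term S V
  | var x => σ x
  | app f ts => app f (fun i => (ts i).subst σ)

/-- A term is closed if no variable occurs in it. -/
def IsClosed (t : Term S V) : Prop := t.vars = ∅

/-- `t.OccursAt x p`: the variable `x` has an occurrence in `t` at position `p`. A position is
the list of argument numbers on the path from the root of `t`. -/
def OccursAt (x : V) : Term S V → List ℕ → Prop
  | var y, p => y = x ∧ p = []
  | app f ts, p => ∃ (i : Fin (S.ar f)) (q : List ℕ), p = (i : ℕ) :: q ∧ (ts i).OccursAt x q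

/-- `t.LiquidAt Λ x p`: the variable `x` has an occurrence in `t` at position `p`, and this is a
`Λ`-liquid position. -/
def LiquidAt (Λ : (f : S.Sym) → Fin (S.ar f) → Prop) (x : V) : Term S V → List ℕ → Prop
  | var y, p => y = x ∧ p = []
  | app f ts, p => ∃ (i : Fin (S.ar f)) (q : List ℕ), p = (i : ℕ) :: q ∧ Λ f i ∧ (ts i).LiquidAt Λ x q

end Term

/-- Literals: `pos t a t'` is the positive literal `t -a-> t'`, and `neg t a` is the negative
literal stating that `t` has no outgoing `a`-transition. -/
inductive Literal (S : Signature.{u}) (V : Type v) (A : Type w) : Type (max u v w)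
  | pos (t : Term S V) (a : A) (t' : Term S V) : Literal S V A
  | neg (t : Term S V) (a : A) : Literal S V A

namespace Literal

/-- The left-hand side of a literal. -/
def lhs : Literal S V A → Term S V
  | pos t _ _ => t
  | neg t _ => t

/-- The right-hand side of a literal, if any. -/
def rhs : Literal S V A → Option (Term S V)
  | pos _ _ t' => some t'
  | neg _ _ => none

/-- Being a positive literal. -/
def IsPos : Literal S V A → Prop
  | pos _ _ _ => True
  | neg _ _ => False

/-- Being a negative literal. -/
def IsNeg (β : Literal S V A) : Prop := ¬ β.IsPos

/-- Being a closed literal. -/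
def IsClosed : Literal S V A → Prop
  | pos t _ t' => t.IsClosed ∧ t'.IsClosed
  | neg t _ => t.IsClosed

/-- Application of a substitution to a literal. -/
def subst (σ : V → Term S V) : Literal S V A → Literal S V A
  | pos t a t' => pos (t.subst σ) a (t'.subst σ)
  | neg t a => neg (t.subst σ) a

/-- `pos t a t'` and `neg t a` deny each other. -/
def Denies : Literal S V A → Literal S V A → Prop
  | pos t a _, neg s b => t = s ∧ a = b
  | neg s b, pos t a _ => t = s ∧ a = b
  | _, _ => False

end Literal

/-- A transition rule: a set of premises and a conclusion. -/
structure Rule (S : Signature.{u}) (V : Type v) (A : Type w) where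
  /-- the premises -/
  premises : Set (Literal S V A)
  /-- the conclusion -/
  concl : Literal S V A

/-- A transition system specification over the signature `S`. -/
structure TSS (S : Signature.{u}) (V : Type v) (A : Type w) where
  /-- the transition rules -/
  rules : Set (Rule S V A)

/-! ### Rule formats -/

namespace Rule

/-- The source of a rule. -/
def source (r : Rule S V A) : Term S V := r.concl.lhs

/-- The set of variables that occur in the target of the rule (empty if there is no target). -/
def targetVars (r : Rule S V A) : Set V := {x | ∃ t, r.concl.rhs = some t ∧ x ∈ t.vars}

/-- An ntytt rule: the right-hand sides of positive premises are variables that are all distinct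
and that do not occur in the source. -/
structure IsNtytt (r : Rule S V A) : Prop where
  rhs_var : ∀ β ∈ r.premises, ∀ t, β.rhs = some t → ∃ y, t = Term.var y ∧ y ∉ r.source.vars
  rhs_distinct : ∀ β ∈ r.premises, ∀ γ ∈ r.premises, ∀ t,
    β.rhs = some t → γ.rhs = some t → β = γ

/-- An ntyxt rule: an ntytt rule whose source is a variable. -/
def IsNtyxt (r : Rule S V A) : Prop := r.IsNtytt ∧ ∃ x, r.source = Term.var x

/-- An ntyft rule: an ntytt rule whose source contains exactly one function symbol and no
multiple occurrences of variables. -/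
def IsNtyft (r : Rule S V A) : Prop :=
  r.IsNtytt ∧ ∃ (f : S.Sym) (xs : Fin (S.ar f) → V),
    Function.Injective xs ∧ r.source = Term.app f (fun i => Term.var (xs i))

/-- No variable that occurs in the right-hand side of a positive premise occurs in the left-hand
side of a premise. -/
def NoLookahead (r : Rule S V A) : Prop :=
  ∀ β ∈ r.premises, ∀ t, β.rhs = some t → ∀ γ ∈ r.premises, ∀ x ∈ t.vars, x ∉ γ.lhs.vars

/-- `x` occurs as the right-hand side of a positive premise, or it occurs exactly once in the
source, at a `Λ`-liquid position. -/
def Floating (Λ : (f : S.Sym) → Fin (S.ar f) → Prop) (r : Rule S V A) (x : V) : Prop :=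
  (∃ β ∈ r.premises, β.rhs = some (Term.var x)) ∨
  ((∃! p, r.source.OccursAt x p) ∧ ∃ p, r.source.LiquidAt Λ x p)

/-- Places in a rule where a tested variable may occur: a position in the target, or a position
in the left-hand side of a premise. -/
inductive Place (S : Signature.{u}) (V : Type v) (A : Type w) : Type (max u v w)
  | target (p : List ℕ) : Place S V A
  | premise (β : Literal S V A) (p : List ℕ) : Place S V A

/-- `β` has a right-hand side, and it occurs in the target (for a rule in which right-hand sides
of premises are variables). -/
def RhsInTarget (r : Rule S V A) (β : Literal S V A) : Prop :=
  ∃ y, β.rhs = some (Term.var y) ∧ y ∈ r.targetVars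

/-- The propagated occurrences of `x`: those in the target, and those in the left-hand side of a
positive premise whose right-hand side occurs in the target. -/
def propagated (r : Rule S V A) (x : V) : Set (Place S V A) :=
  {o | match o with
    | .target p => ∃ t, r.concl.rhs = some t ∧ t.OccursAt x p
    | .premise β p => β ∈ r.premises ∧ r.RhsInTarget β ∧ β.lhs.OccursAt x p}

/-- The polled occurrences of `x`: those in the left-hand side of a premise that does not have a
right-hand side occurring in the target. -/
def polled (r : Rule S V A) (x : V) : Set (Place S V A) :=
  {o | match o with
    | .target _ => False
    | .premise β p => β ∈ r.premises ∧ ¬ r.RhsInTarget β ∧ β.lhs.OccursAt x p}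

/-- The occurrence of `x` at the place `o` is at a `Λ`-liquid position (of the target or of the
left-hand side of the premise, respectively). -/
def LiquidPlace (Λ : (f : S.Sym) → Fin (S.ar f) → Prop) (r : Rule S V A) (x : V) :
    Place S V A → Prop
  | .target p => ∃ t, r.concl.rhs = some t ∧ t.LiquidAt Λ x p
  | .premise β p => β.lhs.LiquidAt Λ x p

/-- The place is in a positive premise. -/
def InPosPremise : Place S V A → Prop
  | .target _ => False
  | .premise β _ => β.IsPos

/-- `Λ`-ready trace safe rules. -/
structure ReadyTraceSafe (Λ : (f : S.Sym) → Fin (S.ar f) → Prop) (r : Rule S V A) : Prop where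
  noLookahead : r.NoLookahead
  propagated_once : ∀ x, r.Floating Λ x → (r.propagated x).Subsingleton
  propagated_liquid : ∀ x, r.Floating Λ x → ∀ o ∈ r.propagated x, r.LiquidPlace Λ x o

/-- `Λ`-readiness safe rules. -/
structure ReadinessSafe (Λ : (f : S.Sym) → Fin (S.ar f) → Prop) (r : Rule S V A) : Prop where
  readyTraceSafe : r.ReadyTraceSafe Λ
  not_both : ∀ x, r.Floating Λ x → ¬ ((r.propagated x).Nonempty ∧ (r.polled x).Nonempty)

/-- `Λ`-failure trace safe rules. -/
structure FailureTraceSafe (Λ : (f : S.Sym) → Fin (S.ar f) → Prop) (r : Rule S V A) : Prop where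
  readinessSafe : r.ReadinessSafe Λ
  polled_once : ∀ x, r.Floating Λ x → (r.polled x).Subsingleton
  polled_liquid : ∀ x, r.Floating Λ x →
    ∀ o ∈ r.polled x, r.LiquidPlace Λ x o ∧ InPosPremise o

end Rule

namespace TSS

/-- All rules have positive conclusions. -/
def IsStandard (P : TSS S V A) : Prop := ∀ r ∈ P.rules, r.concl.IsPos

/-- All rules have positive conclusions and only positive premises. -/
def IsPositive (P : TSS S V A) : Prop :=
  P.IsStandard ∧ ∀ r ∈ P.rules, ∀ β ∈ r.premises, β.IsPos

/-- The ntyft/ntyxt format. -/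
def NtyftNtyxtFormat (P : TSS S V A) : Prop := ∀ r ∈ P.rules, r.IsNtyft ∨ r.IsNtyxt

/-- The failure trace format. -/
def FailureTraceFormat (P : TSS S V A) : Prop :=
  P.IsStandard ∧ P.NtyftNtyxtFormat ∧
    ∃ Λ : (f : S.Sym) → Fin (S.ar f) → Prop, ∀ r ∈ P.rules, r.FailureTraceSafe Λ

/-- The partial trace format. -/
def PartialTraceFormat (P : TSS S V A) : Prop := P.IsPositive ∧ P.FailureTraceFormat

/-! ### Provability -/

/-- `P.Provable K α`: the transition rule with premises `K` and conclusion `α` is provable from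
`P`, that is, there is a well-founded proof tree with root `α` whose hypotheses lie in `K`. -/
inductive Provable (P : TSS S V A) (K : Set (Literal S V A)) : Literal S V A → Prop
  | hyp (α : Literal S V A) (h : α ∈ K) : Provable P K α
  | step (r : Rule S V A) (hr : r ∈ P.rules) (σ : V → Term S V)
      (h : ∀ β ∈ r.premises, Provable P K (β.subst σ)) : Provable P K (r.concl.subst σ)

/-- `P.WSProvable α`: the closed literal `α` has a well-supported proof from `P`. In the
constructor `naf` (negation as failure) the set `K` consists of the labels of the nodes directly
above the node labelled `β`. -/
inductive WSProvable (P : TSS S V A) : Literal S V A → Prop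
  | step (r : Rule S V A) (hr : r ∈ P.rules) (σ : V → Term S V) (hσ : ∀ x, (σ x).IsClosed)
      (h : ∀ β ∈ r.premises, WSProvable P (β.subst σ)) : WSProvable P (r.concl.subst σ)
  | naf (β : Literal S V A) (hβ : β.IsNeg) (hc : β.IsClosed) (K : Set (Literal S V A))
      (hK : ∀ δ ∈ K, WSProvable P δ)
      (h : ∀ (N : Set (Literal S V A)) (γ : Literal S V A),
        (∀ δ ∈ N, δ.IsNeg ∧ δ.IsClosed) → γ.IsClosed → γ.Denies β → P.Provable N γ →
          ∃ δ ∈ K, ∃ ν ∈ N, δ.Denies ν) : WSProvable P β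

end TSS

/-! ### The induced partial trace preorder -/

/-- Closed terms. -/
def ClosedTerm (S : Signature.{u}) (V : Type v) : Type (max u v) := {t : Term S V // t.IsClosed}

/-- Application of a function symbol to closed terms. -/
def ClosedTerm.app (f : S.Sym) (ts : Fin (S.ar f) → ClosedTerm S V) : ClosedTerm S V :=
  ⟨Term.app f (fun i => (ts i).1), Set.iUnion_eq_empty.2 fun i => (ts i).2⟩

/-- Partial trace observations: `⊤` and `aφ`. -/
inductive TraceObs (A : Type w) : Type w
  | top : TraceObs A
  | act (a : A) (φ : TraceObs A) : TraceObs A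

namespace TSS

/-- The satisfaction relation between closed terms and partial trace observations. -/
def Sat (P : TSS S V A) : ClosedTerm S V → TraceObs A → Prop
  | _, .top => True
  | p, .act a φ => ∃ q : ClosedTerm S V, P.WSProvable (.pos p.1 a q.1) ∧ P.Sat q φ

/-- The set of partial trace observations of `p`. -/
def traceObs (P : TSS S V A) (p : ClosedTerm S V) : Set (TraceObs A) := {φ | P.Sat p φ}

/-- The partial trace preorder induced by `P`. -/
def TracePreorder (P : TSS S V A) (p q : ClosedTerm S V) : Prop := P.traceObs p ⊆ P.traceObs q

end TSS

/-- A precongruence: a preorder on closed terms that is preserved by all function symbols. -/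
structure IsPrecongruence (R : ClosedTerm S V → ClosedTerm S V → Prop) : Prop where
  refl : ∀ p, R p p
  trans : ∀ p q r, R p q → R q r → R p r
  app : ∀ (f : S.Sym) (p q : Fin (S.ar f) → ClosedTerm S V),
    (∀ i, R (p i) (q i)) → R (ClosedTerm.app f p) (ClosedTerm.app f q)

end SOS

/-! Observations are decomposed along open terms. Fix a set `L` of variables, each with at most one
occurrence in `t`, and only at a liquid position. If a closed instance of `t` satisfies `φ`, then
one observation of the value of each variable in `L`, together with all observations of the other
values, already guarantees `φ` (`Decomposes`, proved in `decomposes`). The theorem is the case `t =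
f(x₁, …, xₙ)`, `L = ∅`.

Nonempty `L` is forced by the induction. Once values are replaced, a premise `u -b-> y` is proved
again with a new residual for `y`, of which only one observation is known. The rest of the
observation is therefore decomposed over the target first; it demands some `ψ` of `y`, and then `bψ`
is decomposed over `u` (`decomposes_rule`). A floating variable has at most one place among target
and premises, so no two demands on it have to be merged. Without lookahead the new residuals leave
the left-hand sides of premises unchanged, and positivity leaves no other premises to check.

The target is handled by induction on the length of the observation, the premises by an inner
induction on the proof of the first transition (`decomposes_act`). -/

namespace SOS

variable {S : Signature.{u}} {V : Type v} {A : Type w} {W X Y : Type*}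

/-! ### Substitution, positions and linear variables -/

namespace Term

/-- Simultaneous substitution, possibly changing the set of variables. -/
def bind (σ : W → Term S X) : Term S W → Term S X
  | var x => σ x
  | app f ts => app f (fun i => (ts i).bind σ)

theorem subst_eq_bind (σ : V → Term S V) (t : Term S V) : t.subst σ = t.bind σ := by
  induction t with
  | var x => rfl
  | app f ts ih => simp only [subst, bind, ih]

theorem bind_bind (σ : W → Term S X) (τ : X → Term S Y) (t : Term S W) :
    (t.bind σ).bind τ = t.bind (fun x => (σ x).bind τ) := by
  induction t with
  | var x => rfl
  | app f ts ih => simp only [bind, ih]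

theorem bind_congr {σ τ : W → Term S X} {t : Term S W} (h : ∀ x ∈ t.vars, σ x = τ x) :
    t.bind σ = t.bind τ := by
  induction t with
  | var x => exact h x rfl
  | app f ts ih =>
    simp only [bind]
    congr 1
    funext i
    exact ih i fun x hx => h x (Set.mem_iUnion.2 ⟨i, hx⟩)

theorem mem_vars_bind {σ : W → Term S X} {t : Term S W} {x : X} :
    x ∈ (t.bind σ).vars ↔ ∃ z ∈ t.vars, x ∈ (σ z).vars := by
  induction t with
  | var y => simp [bind, vars]
  | app f ts ih =>
    simp only [bind, vars, Set.mem_iUnion, ih]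
    constructor
    · rintro ⟨i, z, hz, hx⟩
      exact ⟨z, ⟨i, hz⟩, hx⟩
    · rintro ⟨z, ⟨i, hz⟩, hx⟩
      exact ⟨i, z, hz, hx⟩

theorem mem_vars_iff {t : Term S W} {x : W} : x ∈ t.vars ↔ ∃ p, t.OccursAt x p := by
  induction t with
  | var y => simp [vars, OccursAt, eq_comm]
  | app f ts ih =>
    simp only [vars, Set.mem_iUnion, ih, OccursAt]
    constructor
    · rintro ⟨i, q, hq⟩
      exact ⟨_, i, q, rfl, hq⟩
    · rintro ⟨_, i, q, rfl, hq⟩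
      exact ⟨i, q, hq⟩

theorem occursAt_bind {σ : W → Term S X} {t : Term S W} {x : X} {p : List ℕ} :
    (t.bind σ).OccursAt x p ↔
      ∃ z q r, p = q ++ r ∧ t.OccursAt z q ∧ (σ z).OccursAt x r := by
  induction t generalizing p with
  | var y =>
    constructor
    · intro h
      exact ⟨y, [], p, rfl, ⟨rfl, rfl⟩, h⟩
    · rintro ⟨z, q, r, rfl, ⟨rfl, rfl⟩, h⟩
      exact h
  | app f ts ih =>
    simp only [bind, OccursAt, ih]
    constructor
    · rintro ⟨i, _, rfl, z, q, r, rfl, hq, hr⟩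
      exact ⟨z, i :: q, r, rfl, ⟨i, q, rfl, hq⟩, hr⟩
    · rintro ⟨z, _, r, rfl, ⟨i, q, rfl, hq⟩, hr⟩
      exact ⟨i, q ++ r, rfl, z, q, r, rfl, hq, hr⟩

variable {Λ : (f : S.Sym) → Fin (S.ar f) → Prop}

theorem LiquidAt.occursAt {t : Term S W} {x : W} {p : List ℕ} (h : t.LiquidAt Λ x p) :
    t.OccursAt x p := by
  induction t generalizing p with
  | var y => exact h
  | app f ts ih =>
    obtain ⟨i, q, rfl, -, hq⟩ := h
    exact ⟨i, q, rfl, ih i hq⟩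

theorem liquidAt_bind {σ : W → Term S X} {t : Term S W} {x : X} {p : List ℕ} :
    (t.bind σ).LiquidAt Λ x p ↔
      ∃ z q r, p = q ++ r ∧ t.LiquidAt Λ z q ∧ (σ z).LiquidAt Λ x r := by
  induction t generalizing p with
  | var y =>
    constructor
    · intro h
      exact ⟨y, [], p, rfl, ⟨rfl, rfl⟩, h⟩
    · rintro ⟨z, q, r, rfl, ⟨rfl, rfl⟩, h⟩
      exact h
  | app f ts ih =>
    simp only [bind, LiquidAt, ih]
    constructor
    · rintro ⟨i, _, rfl, hi, z, q, r, rfl, hq, hr⟩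
      exact ⟨z, i :: q, r, rfl, ⟨i, q, rfl, hi, hq⟩, hr⟩
    · rintro ⟨z, _, r, rfl, ⟨i, q, rfl, hi, hq⟩, hr⟩
      exact ⟨i, q ++ r, rfl, hi, z, q, r, rfl, hq, hr⟩

/-- Positions of variables are pairwise incomparable in the prefix order. -/
theorem OccursAt.eq_of_append_eq {t : Term S W} {x y : W} {p q r s : List ℕ}
    (hx : t.OccursAt x p) (hy : t.OccursAt y q) (h : p ++ r = q ++ s) :
    x = y ∧ p = q ∧ r = s := by
  induction t generalizing p q with
  | var z =>
    obtain ⟨rfl, rfl⟩ := hx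
    obtain ⟨rfl, rfl⟩ := hy
    exact ⟨rfl, rfl, h⟩
  | app f ts ih =>
    obtain ⟨i, p, rfl, hp⟩ := hx
    obtain ⟨j, q, rfl, hq⟩ := hy
    simp only [List.cons_append, List.cons.injEq] at h
    obtain rfl : i = j := Fin.ext h.1
    obtain ⟨h1, rfl, h3⟩ := ih i hp hq h.2
    exact ⟨h1, rfl, h3⟩

theorem occursAt_rename {g : W → X} (hg : g.Injective) {t : Term S W} {x : W} {p : List ℕ} :
    (t.bind fun y => var (g y)).OccursAt (g x) p ↔ t.OccursAt x p := by
  rw [occursAt_bind]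
  constructor
  · rintro ⟨z, q, r, rfl, hq, hz, rfl⟩
    rw [List.append_nil, ← hg hz]
    exact hq
  · intro h
    exact ⟨x, p, [], by simp, h, rfl, rfl⟩

theorem LiquidAt.rename (g : W → X) {t : Term S W} {x : W} {p : List ℕ}
    (h : t.LiquidAt Λ x p) : (t.bind fun y => var (g y)).LiquidAt Λ (g x) p :=
  liquidAt_bind.2 ⟨x, p, [], by simp, h, rfl, rfl⟩

/-- Each variable of `L` has at most one occurrence in `t`, and only at a liquid position. -/
structure Linear (Λ : (f : S.Sym) → Fin (S.ar f) → Prop) (L : Set W) (t : Term S W) : Prop where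
  unique : ∀ x ∈ L, ∀ p q, t.OccursAt x p → t.OccursAt x q → p = q
  liquid : ∀ x ∈ L, ∀ p, t.OccursAt x p → t.LiquidAt Λ x p

theorem isClosed_bind {t : Term S W} {σ : W → Term S V} (h : ∀ x, (σ x).IsClosed) :
    (t.bind σ).IsClosed := by
  refine Set.eq_empty_iff_forall_notMem.2 fun x hx => ?_
  obtain ⟨z, -, hz⟩ := mem_vars_bind.1 hx
  rw [h z] at hz
  exact hz

/-- The closed term obtained from `t` by a closed substitution. -/
def close (t : Term S W) (σ : W → ClosedTerm S V) : ClosedTerm S V :=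
  ⟨t.bind fun x => (σ x).1, isClosed_bind fun x => (σ x).2⟩

theorem close_bind (t : Term S W) (η : W → Term S X) (σ : X → ClosedTerm S V) :
    (t.bind η).close σ = t.close fun z => (η z).close σ :=
  Subtype.ext (bind_bind _ _ _)

theorem close_congr {t : Term S W} {σ τ : W → ClosedTerm S V} (h : ∀ x ∈ t.vars, σ x = τ x) :
    t.close σ = t.close τ :=
  Subtype.ext (bind_congr fun x hx => by rw [h x hx])

end Term

/-! ### Places of floating variables in instantiated rules -/

namespace Rule

variable {Λ : (f : S.Sym) → Fin (S.ar f) → Prop} {r : Rule S V A}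

theorem FailureTraceSafe.liquid (h : r.FailureTraceSafe Λ) {x : V} (hx : r.Floating Λ x)
    {o : Place S V A} (ho : o ∈ r.propagated x ∪ r.polled x) : r.LiquidPlace Λ x o :=
  ho.elim (h.readinessSafe.readyTraceSafe.propagated_liquid x hx o)
    fun ho => (h.polled_liquid x hx o ho).1

/-- At most one propagated place, at most one polled place, and never both kinds: together at most
one place in target and premises. -/
theorem FailureTraceSafe.unique (h : r.FailureTraceSafe Λ) {x : V} (hx : r.Floating Λ x)
    {o o' : Place S V A} (ho : o ∈ r.propagated x ∪ r.polled x)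
    (ho' : o' ∈ r.propagated x ∪ r.polled x) : o = o' := by
  have hn := h.readinessSafe.not_both x hx
  rcases ho with ho | ho <;> rcases ho' with ho' | ho'
  · exact h.readinessSafe.readyTraceSafe.propagated_once x hx ho ho'
  · exact (hn ⟨⟨_, ho⟩, ⟨_, ho'⟩⟩).elim
  · exact (hn ⟨⟨_, ho'⟩, ⟨_, ho⟩⟩).elim
  · exact h.polled_once x hx ho ho'

theorem target_mem_places {t : Term S V} (ht : r.concl.rhs = some t) {x : V} {p : List ℕ}
    (h : t.OccursAt x p) : Place.target p ∈ r.propagated x ∪ r.polled x :=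
  Or.inl ⟨t, ht, h⟩

theorem premise_mem_places {β : Literal S V A} (hβ : β ∈ r.premises) {x : V} {p : List ℕ}
    (h : β.lhs.OccursAt x p) : Place.premise β p ∈ r.propagated x ∪ r.polled x := by
  by_cases hr : r.RhsInTarget β
  · exact Or.inl ⟨hβ, hr, h⟩
  · exact Or.inr ⟨hβ, hr, h⟩

/-- The variables of the source are instantiated by `η`; all others are kept, on a separate
summand. -/
noncomputable def instantiate (r : Rule S V A) (η : V → Term S W) (z : V) : Term S (W ⊕ V) :=
  open Classical in
  if z ∈ r.source.vars then (η z).bind fun x => .var (.inl x) else .var (.inr z)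

theorem occursAt_inl {η : V → Term S W} {t : Term S V} {x : W} {p : List ℕ}
    (h : (t.bind (r.instantiate η)).OccursAt (.inl x) p) :
    ∃ z ∈ r.source.vars, ∃ q s, p = q ++ s ∧ t.OccursAt z q ∧ (η z).OccursAt x s := by
  obtain ⟨z, q, s, rfl, hq, hs⟩ := Term.occursAt_bind.1 h
  unfold instantiate at hs
  split_ifs at hs with hz
  · exact ⟨z, hz, q, s, rfl, hq, (Term.occursAt_rename Sum.inl_injective).1 hs⟩
  · cases hs.1

theorem occursAt_inr {η : V → Term S W} {t : Term S V} {y : V} {p : List ℕ}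
    (h : (t.bind (r.instantiate η)).OccursAt (.inr y) p) :
    y ∉ r.source.vars ∧ t.OccursAt y p := by
  obtain ⟨z, q, s, rfl, hq, hs⟩ := Term.occursAt_bind.1 h
  unfold instantiate at hs
  split_ifs at hs with hz
  · obtain ⟨_, _, _, -, -, hh, -⟩ := Term.occursAt_bind.1 hs
    cases hh
  · obtain ⟨hh, rfl⟩ := hs
    cases hh
    exact ⟨hz, by simpa using hq⟩

/-- The variables of the instantiated rule that have to be treated linearly. -/
def linearVars (r : Rule S V A) (L : Set W) : Set (W ⊕ V) :=
  Sum.elim (· ∈ L) fun y => ∃ β ∈ r.premises, β.rhs = some (.var y)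

section

variable {L : Set W} {η : V → Term S W} (hL : (r.source.bind η).Linear Λ L)
include hL

/-- Two occurrences of `z` in the source would yield two of `x`. The position of `x` passes through
that of `z`, and a prefix of a liquid position is liquid. -/
theorem floating_of_mem {x : W} (hx : x ∈ L) {z : V} (hz : z ∈ r.source.vars)
    (hxz : x ∈ (η z).vars) : r.Floating Λ z := by
  obtain ⟨q, hq⟩ := Term.mem_vars_iff.1 hz
  obtain ⟨s, hs⟩ := Term.mem_vars_iff.1 hxz
  refine Or.inr ⟨⟨q, hq, fun q' hq' => ?_⟩, q, ?_⟩
  · exact List.append_cancel_right (hL.unique x hx (q' ++ s) (q ++ s)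
      (Term.occursAt_bind.2 ⟨z, q', s, rfl, hq', hs⟩)
      (Term.occursAt_bind.2 ⟨z, q, s, rfl, hq, hs⟩))
  · obtain ⟨z', q', s', he, hq', hs'⟩ := Term.liquidAt_bind.1
      (hL.liquid x hx (q ++ s) (Term.occursAt_bind.2 ⟨z, q, s, rfl, hq, hs⟩))
    obtain ⟨rfl, rfl, rfl⟩ := hq.eq_of_append_eq hq'.occursAt he
    exact hq'

/-- Both occurrences extend to the unique position of `x` in the instantiated source, and variable
positions are prefix-incomparable. -/
theorem eq_of_mem {x : W} (hx : x ∈ L) {z z' : V} (hz : z ∈ r.source.vars)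
    (hz' : z' ∈ r.source.vars) {s s' : List ℕ} (hs : (η z).OccursAt x s)
    (hs' : (η z').OccursAt x s') : z = z' ∧ s = s' := by
  obtain ⟨q, hq⟩ := Term.mem_vars_iff.1 hz
  obtain ⟨q', hq'⟩ := Term.mem_vars_iff.1 hz'
  obtain ⟨h1, -, h2⟩ := hq.eq_of_append_eq hq' (hL.unique x hx (q ++ s) (q' ++ s')
      (Term.occursAt_bind.2 ⟨z, q, s, rfl, hq, hs⟩)
      (Term.occursAt_bind.2 ⟨z', q', s', rfl, hq', hs'⟩))
  exact ⟨h1, h2⟩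

theorem liquid_of_mem {x : W} (hx : x ∈ L) {z : V} (hz : z ∈ r.source.vars) {s : List ℕ}
    (hs : (η z).OccursAt x s) : (η z).LiquidAt Λ x s := by
  obtain ⟨q, hq⟩ := Term.mem_vars_iff.1 hz
  obtain ⟨z', q', s', he, hq', hs'⟩ := Term.liquidAt_bind.1
    (hL.liquid x hx (q ++ s) (Term.occursAt_bind.2 ⟨z, q, s, rfl, hq, hs⟩))
  obtain ⟨rfl, rfl, rfl⟩ := hq.eq_of_append_eq hq'.occursAt he
  exact hs'

/-- Linearity is inherited by an instantiated term all of whose floating variables occur at most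
once, at a liquid position. -/
theorem linear_bind {t : Term S V}
    (hu : ∀ z, r.Floating Λ z → ∀ p q, t.OccursAt z p → t.OccursAt z q → p = q)
    (hl : ∀ z, r.Floating Λ z → ∀ p, t.OccursAt z p → t.LiquidAt Λ z p) :
    (t.bind (r.instantiate η)).Linear Λ (r.linearVars L) := by
  constructor
  · rintro (x | y) hx p p' hp hp'
    · obtain ⟨z, hz, q, s, rfl, hq, hs⟩ := occursAt_inl hp
      obtain ⟨z', hz', q', s', rfl, hq', hs'⟩ := occursAt_inl hp'
      obtain ⟨rfl, rfl⟩ := eq_of_mem hL hx hz hz' hs hs'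
      rw [hu z (floating_of_mem hL hx hz (Term.mem_vars_iff.2 ⟨_, hs⟩)) q q' hq hq']
    · exact hu y (Or.inl hx) _ _ (occursAt_inr hp).2 (occursAt_inr hp').2
  · rintro (x | y) hx p hp
    · obtain ⟨z, hz, q, s, rfl, hq, hs⟩ := occursAt_inl hp
      refine Term.liquidAt_bind.2 ⟨z, q, s, rfl,
        hl z (floating_of_mem hL hx hz (Term.mem_vars_iff.2 ⟨_, hs⟩)) q hq, ?_⟩
      rw [instantiate, if_pos hz]
      exact (liquid_of_mem hL hx hz hs).rename _
    · obtain ⟨hy, hp⟩ := occursAt_inr hp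
      refine Term.liquidAt_bind.2 ⟨y, p, [], by simp, hl y (Or.inl hx) p hp, ?_⟩
      rw [instantiate, if_neg hy]
      exact ⟨rfl, rfl⟩

/-- A linear variable determines the source variable by which it enters the rule, and hence the
only place of the rule where it may occur. -/
theorem places_eq (hs : r.FailureTraceSafe Λ) {x : W} (hx : x ∈ L) {z z' : V}
    (hz : z ∈ r.source.vars) (hz' : z' ∈ r.source.vars) (hxz : x ∈ (η z).vars)
    (hxz' : x ∈ (η z').vars) {o o' : Place S V A} (ho : o ∈ r.propagated z ∪ r.polled z)
    (ho' : o' ∈ r.propagated z' ∪ r.polled z') : o = o' := by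
  have hf := floating_of_mem hL hx hz hxz
  obtain ⟨p, hp⟩ := Term.mem_vars_iff.1 hxz
  obtain ⟨p', hp'⟩ := Term.mem_vars_iff.1 hxz'
  obtain ⟨rfl, -⟩ := eq_of_mem hL hx hz hz' hp hp'
  exact hs.unique hf ho ho'

end

end Rule

/-! ### Decomposition of observations -/

/-- The number of actions in an observation. -/
def TraceObs.length : TraceObs A → ℕ
  | .top => 0
  | .act _ φ => φ.length + 1

namespace TSS

variable {P : TSS S V A}

/-- The observation `φ` of the closed instance `t.close σ` is guaranteed by one observation of
`σ x` for each `x ∈ L` that occurs in `t`, and all observations of `σ x` for `x ∉ L`. -/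
def Decomposes (P : TSS S V A) (t : Term S W) (σ : W → ClosedTerm S V) (L : Set W)
    (φ : TraceObs A) : Prop :=
  ∃ θ : W → TraceObs A, (∀ x, (θ x).length ≤ φ.length) ∧ (∀ x ∈ L, P.Sat (σ x) (θ x)) ∧
    ∀ ρ : W → ClosedTerm S V, (∀ x ∈ L, x ∈ t.vars → P.Sat (ρ x) (θ x)) →
      (∀ x ∉ L, P.TracePreorder (σ x) (ρ x)) → P.Sat (t.close ρ) φ

theorem decomposes_var (x : W) (σ : W → ClosedTerm S V) (L : Set W) (φ : TraceObs A)
    (h : P.Sat (σ x) φ) : P.Decomposes (.var x) σ L φ := by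
  classical
  -- All of `φ` is demanded of `x`, and the trivial observation of every other variable.
  refine ⟨fun y => if y = x then φ else .top, fun y => ?_, fun y _ => ?_, fun ρ hρ hρ' => ?_⟩
  · dsimp only
    split_ifs
    · exact le_rfl
    · exact Nat.zero_le _
  · dsimp only
    split_ifs with hy
    · exact hy ▸ h
    · trivial
  · show P.Sat (ρ x) φ
    by_cases hx : x ∈ L
    · simpa using hρ x hx rfl
    · exact hρ' x hx h

theorem decomposes_top (t : Term S W) (σ : W → ClosedTerm S V) (L : Set W) :
    P.Decomposes t σ L .top :=
  ⟨fun _ => .top, fun _ => le_rfl, fun _ _ => trivial, fun _ _ _ => trivial⟩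

end TSS

end SOS

namespace SOS

variable {S : Signature.{u}} {V : Type v} {A : Type w} {W X Y : Type*}

/-! ### Decomposition through rules and proofs -/

namespace TSS

variable {P : TSS S V A}

theorem TracePreorder.refl (p : ClosedTerm S V) : P.TracePreorder p p := fun _ h => h

variable {Λ : (f : S.Sym) → Fin (S.ar f) → Prop} {r : Rule S V A}

/-- The decomposition of an observation through the last rule applied for its first action. -/
theorem decomposes_rule (hr : r ∈ P.rules) (hn : r.IsNtytt) (hs : r.FailureTraceSafe Λ)
    (hpos : ∀ β ∈ r.premises, β.IsPos) {s : Term S V} {a : A} {t' : Term S V}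
    (hc : r.concl = .pos s a t') (τ : V → ClosedTerm S V) {η : V → Term S W}
    {σ : W → ClosedTerm S V} {L : Set W}
    (hL : (r.source.bind η).Linear Λ L) {φ : TraceObs A}
    (ht : (t'.bind (r.instantiate η)).Linear Λ (r.linearVars L) →
      P.Decomposes (t'.bind (r.instantiate η)) (Sum.elim σ τ) (r.linearVars L) φ)
    (hp : ∀ u b y, Literal.pos u b (.var y) ∈ r.premises → ∀ ψ : TraceObs A,
      ψ.length ≤ φ.length → P.Sat (τ y) ψ →
      (u.bind (r.instantiate η)).Linear Λ (r.linearVars L) →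
      P.Decomposes (u.bind (r.instantiate η)) (Sum.elim σ τ) (r.linearVars L) (.act b ψ)) :
    P.Decomposes (r.source.bind η) σ L (.act a φ) := by
  classical
  have htgt : r.concl.rhs = some t' := by rw [hc]; rfl
  obtain ⟨θ₀, hθ₀, hσ₀, hρ₀⟩ := ht (Rule.linear_bind hL
    (fun z hz p q h h' => by
      simpa using hs.unique hz (Rule.target_mem_places htgt h) (Rule.target_mem_places htgt h'))
    (fun z hz p h => by
      obtain ⟨_, e, h'⟩ := hs.liquid hz (Rule.target_mem_places htgt h)
      rw [htgt, Option.some.injEq] at e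
      exact e ▸ h'))
  -- `θ₀ (.inr y)` is what the target demands of the residual `y`, so the left-hand side must offer
  -- `b` followed by it.
  have key : ∀ u b y, Literal.pos u b (.var y) ∈ r.premises →
      P.Decomposes (u.bind (r.instantiate η)) (Sum.elim σ τ) (r.linearVars L)
        (.act b (θ₀ (.inr y))) := fun u b y h =>
    hp u b y h _ (hθ₀ _) (hσ₀ (.inr y) ⟨_, h, rfl⟩) (Rule.linear_bind hL
      (fun z hz p q h1 h2 => by
        simpa using hs.unique hz (Rule.premise_mem_places h h1) (Rule.premise_mem_places h h2))
      (fun z hz p h1 => hs.liquid hz (Rule.premise_mem_places h h1)))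
  choose θ₁ hθ₁ hσ₁ hρ₁ using key
  -- a linear variable occurs in at most one of the instantiated target and left-hand sides
  have split : ∀ x : W, ∃ ψ : TraceObs A, ψ.length ≤ φ.length + 1 ∧ (x ∈ L → P.Sat (σ x) ψ) ∧
      (x ∈ L → .inl x ∈ (t'.bind (r.instantiate η)).vars → ψ = θ₀ (.inl x)) ∧
      ∀ u b y (h : Literal.pos u b (.var y) ∈ r.premises), x ∈ L →
        .inl x ∈ (u.bind (r.instantiate η)).vars → ψ = θ₁ u b y h (.inl x) := by
    intro x
    have tgt : .inl x ∈ (t'.bind (r.instantiate η)).vars → ∃ z ∈ r.source.vars, x ∈ (η z).vars ∧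
        ∃ q, Rule.Place.target q ∈ r.propagated z ∪ r.polled z := by
      intro h
      obtain ⟨p, hp⟩ := Term.mem_vars_iff.1 h
      obtain ⟨z, hz, q, s, -, hq, hs⟩ := Rule.occursAt_inl hp
      exact ⟨z, hz, Term.mem_vars_iff.2 ⟨s, hs⟩, q, Rule.target_mem_places htgt hq⟩
    have prem : ∀ u b y, Literal.pos u b (.var y) ∈ r.premises →
        .inl x ∈ (u.bind (r.instantiate η)).vars → ∃ z ∈ r.source.vars, x ∈ (η z).vars ∧
        ∃ q, Rule.Place.premise (.pos u b (.var y)) q ∈ r.propagated z ∪ r.polled z := by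
      intro u b y hm h
      obtain ⟨p, hp⟩ := Term.mem_vars_iff.1 h
      obtain ⟨z, hz, q, s, -, hq, hs⟩ := Rule.occursAt_inl hp
      exact ⟨z, hz, Term.mem_vars_iff.2 ⟨s, hs⟩, q, Rule.premise_mem_places hm hq⟩
    by_cases h₀ : .inl x ∈ (t'.bind (r.instantiate η)).vars
    · refine ⟨θ₀ (.inl x), (hθ₀ _).trans (Nat.le_succ _), fun hx => hσ₀ (.inl x) hx,
        fun _ _ => rfl, fun u b y h hx hu => ?_⟩
      obtain ⟨z, hz, hxz, q, hq⟩ := tgt h₀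
      obtain ⟨z', hz', hxz', q', hq'⟩ := prem u b y h hu
      -- A place in the target is never a place in a premise.
      cases Rule.places_eq hL hs hx hz hz' hxz hxz' hq hq'
    by_cases h₁ : ∃ u b y, ∃ _ : Literal.pos u b (.var y) ∈ r.premises,
        .inl x ∈ (u.bind (r.instantiate η)).vars
    · obtain ⟨u, b, y, h, hu⟩ := h₁
      refine ⟨θ₁ u b y h (.inl x), (hθ₁ u b y h _).trans (Nat.succ_le_succ (hθ₀ _)),
        fun hx => hσ₁ u b y h (.inl x) hx, fun _ h => (h₀ h).elim, fun u' b' y' h' hx hu' => ?_⟩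
      obtain ⟨z, hz, hxz, q, hq⟩ := prem u b y h hu
      obtain ⟨z', hz', hxz', q', hq'⟩ := prem u' b' y' h' hu'
      -- Equal places lie in the same premise, so both demands come from one decomposition.
      cases Rule.places_eq hL hs hx hz hz' hxz hxz' hq hq'
      rfl
    · exact ⟨.top, Nat.zero_le _, fun _ => trivial, fun _ h => (h₀ h).elim,
        fun u b y h _ hu => (h₁ ⟨u, b, y, h, hu⟩).elim⟩
  choose θ hθ hσ hθt hθp using split
  refine ⟨θ, hθ, hσ, fun ρ hρ hρ' => ?_⟩
  -- the variables of the instantiated source are those of the `η z`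
  have hvars : ∀ (v : Term S V) x, .inl x ∈ (v.bind (r.instantiate η)).vars →
      x ∈ (r.source.bind η).vars := fun v x h => by
    obtain ⟨p, hp⟩ := Term.mem_vars_iff.1 h
    obtain ⟨z, hz, q, s, -, -, hs⟩ := Rule.occursAt_inl hp
    exact Term.mem_vars_bind.2 ⟨z, hz, Term.mem_vars_iff.2 ⟨s, hs⟩⟩
  have look : ∀ u b y, Literal.pos u b (.var y) ∈ r.premises → ∀ y',
      .inr y' ∈ (u.bind (r.instantiate η)).vars → ¬ ∃ β ∈ r.premises, β.rhs = some (.var y') := by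
    rintro u b y h y' hy' ⟨β, hβ, e⟩
    obtain ⟨p, hp⟩ := Term.mem_vars_iff.1 hy'
    exact hs.readinessSafe.readyTraceSafe.noLookahead β hβ _ e _ h y' rfl
      (Term.mem_vars_iff.2 ⟨p, (Rule.occursAt_inr hp).2⟩)
  have step : ∀ u b y, Literal.pos u b (.var y) ∈ r.premises →
      P.Sat ((u.bind (r.instantiate η)).close (Sum.elim ρ τ)) (.act b (θ₀ (.inr y))) := by
    intro u b y h
    apply hρ₁ u b y h
    · rintro (x | y') hx hxu
      · rw [← hθp x u b y h hx hxu]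
        exact hρ x hx (hvars _ _ hxu)
      · exact (look u b y h y' hxu hx).elim
    · rintro (x | y') hx
      · exact hρ' x hx
      · exact TracePreorder.refl _
  -- Right-hand sides are distinct, so `y` determines its premise and a single residual serves.
  -- Variables that are no right-hand side keep their value under `τ`.
  have residual : ∀ y, ∃ R : ClosedTerm S V,
      (∀ u b, Literal.pos u b (.var y) ∈ r.premises →
        P.WSProvable (.pos ((u.bind (r.instantiate η)).close (Sum.elim ρ τ)).1 b R.1) ∧
          P.Sat R (θ₀ (.inr y))) ∧
      ((¬ ∃ β ∈ r.premises, β.rhs = some (.var y)) → R = τ y) := by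
    intro y
    by_cases hy : ∃ u b, Literal.pos u b (.var y) ∈ r.premises
    · obtain ⟨u, b, h⟩ := hy
      obtain ⟨R, hR⟩ := step u b y h
      refine ⟨R, fun u' b' h' => ?_, fun hy => (hy ⟨_, h, rfl⟩).elim⟩
      cases hn.rhs_distinct _ h _ h' _ rfl rfl
      exact hR
    · exact ⟨τ y, fun u b h => (hy ⟨u, b, h⟩).elim, fun _ => rfl⟩
  choose R hR hRτ using residual
  -- By the absence of lookahead, `R` and `τ` agree on the variables of `u`.
  have hclose : ∀ u b y, Literal.pos u b (.var y) ∈ r.premises →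
      (u.bind (r.instantiate η)).close (Sum.elim ρ R) = (u.bind (r.instantiate η)).close (Sum.elim ρ τ) := by
    intro u b y h
    refine Term.close_congr ?_
    rintro (x | y') hx
    · rfl
    · exact hRτ y' (look u b y h y' hx)
  have hsrc : (r.source.bind (r.instantiate η)).close (Sum.elim ρ R) = (r.source.bind η).close ρ := by
    rw [Term.close_bind, Term.close_bind]
    refine Term.close_congr fun z hz => ?_
    rw [Rule.instantiate, if_pos hz, Term.close_bind]
    rfl
  refine ⟨(t'.bind (r.instantiate η)).close (Sum.elim ρ R), ?_, hρ₀ _ ?_ ?_⟩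
  · have hw := WSProvable.step r hr (fun z => ((r.instantiate η z).close (Sum.elim ρ R)).1)
      (fun z => ((r.instantiate η z).close (Sum.elim ρ R)).2) (fun β hβ => by
        obtain ⟨u, b, v⟩ | ⟨u, b⟩ := β
        · obtain ⟨y, rfl, hy⟩ := hn.rhs_var _ hβ v rfl
          have h1 := (hR y u b hβ).1
          rw [← hclose u b y hβ, Term.close_bind] at h1
          have h2 : ((r.instantiate η y).close (Sum.elim ρ R)) = R y := by
            rw [Rule.instantiate, if_neg hy]
            rfl
          simp only [Literal.subst, Term.subst_eq_bind, Term.bind, h2]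
          exact h1
        · exact (hpos _ hβ).elim)
    have e : r.source = s := by rw [Rule.source, hc]; rfl
    rw [← hsrc, Term.close_bind, Term.close_bind, e]
    rw [hc] at hw
    simp only [Literal.subst, Term.subst_eq_bind] at hw
    exact hw
  · rintro (x | y) hx hxt
    · rw [← hθt x hx hxt]
      exact hρ x hx (hvars _ _ hxt)
    · obtain ⟨β, hβ, e⟩ := hx
      obtain ⟨u, b, v⟩ | ⟨u, b⟩ := β
      · cases e
        exact (hR y u b hβ).2
      · cases e
  · rintro (x | y) hx
    · exact hρ' x hx
    · have : R y = τ y := hRτ y hx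
      simp only [Sum.elim_inr, this]
      exact TracePreorder.refl _

/-- An application whose instance by `σ` is an instance of the source of an ntyft or ntyxt rule is
itself an instance of that source. -/
theorem exists_bind_source_eq (h : r.IsNtyft ∨ r.IsNtyxt) (τ : V → ClosedTerm S V)
    (σ : W → ClosedTerm S V) (f : S.Sym) (ts : Fin (S.ar f) → Term S W)
    (e : r.source.close τ = (Term.app f ts).close σ) :
    ∃ η : V → Term S W, r.source.bind η = .app f ts ∧
      ∀ z ∈ r.source.vars, (η z).close σ = τ z := by
  rcases h with ⟨-, g, xs, hxs, hsrc⟩ | ⟨-, x, hsrc⟩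
  · rw [hsrc] at e ⊢
    have e' := congrArg Subtype.val e
    simp only [Term.close, Term.bind, Term.app.injEq] at e'
    obtain ⟨rfl, e'⟩ := e'
    refine ⟨Function.extend xs ts fun _ => .app g ts, ?_, fun z hz => ?_⟩
    · simp only [Term.bind, hxs.extend_apply]
    · obtain ⟨i, rfl⟩ := Set.mem_iUnion.1 hz
      rw [hxs.extend_apply]
      exact Subtype.ext (congrFun (eq_of_heq e') i).symm
  · rw [hsrc] at e ⊢
    refine ⟨fun _ => .app f ts, rfl, fun z hz => ?_⟩
    cases hz
    exact e.symm

/-- Induction on the proof of the transition, general in `W`, `t`, `σ` and `L` because left-hand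
sides of premises become terms over `W ⊕ V`; taking `W : Type v` keeps this sum in the same
universe. The bound `φ.length ≤ n`, instead of a fixed `φ`, admits the demands that the target makes
on residuals. -/
theorem decomposes_act (hP : P.IsPositive) (hF : P.NtyftNtyxtFormat)
    (hΛ : ∀ r ∈ P.rules, r.FailureTraceSafe Λ) (n : ℕ)
    (ih : ∀ (W : Type v) (t : Term S W) (σ : W → ClosedTerm S V) (L : Set W) (φ : TraceObs A),
      φ.length ≤ n → t.Linear Λ L → P.Sat (t.close σ) φ → P.Decomposes t σ L φ)
    {α : Literal S V A} (hα : P.WSProvable α) :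
    ∀ (p q : ClosedTerm S V) (a : A), α = .pos p.1 a q.1 → ∀ (W : Type v) (t : Term S W)
      (σ : W → ClosedTerm S V) (L : Set W) (φ : TraceObs A), φ.length ≤ n → t.Linear Λ L →
      t.close σ = p → P.Sat q φ → P.Decomposes t σ L (.act a φ) := by
  induction hα with
  | naf β hβ =>
    intro p q a e
    exact (hβ (e ▸ trivial)).elim
  | step r hr τ hτ h ihp =>
    intro p q a e W t σ L φ hφ hL htp hq
    obtain ⟨s, a', t', hc⟩ : ∃ s a t', r.concl = .pos s a t' := by
      have := hP.1 r hr
      revert this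
      cases r.concl with
      | pos s a t' => exact fun _ => ⟨s, a, t', rfl⟩
      | neg => exact False.elim
    have hsrc : r.source = s := by rw [Rule.source, hc]; rfl
    have hw : P.WSProvable (.pos p.1 a q.1) := e ▸ WSProvable.step r hr τ hτ h
    rw [hc] at e
    simp only [Literal.subst, Term.subst_eq_bind, Literal.pos.injEq] at e
    obtain ⟨hp, rfl, hq'⟩ := e
    cases t with
    -- A variable passes the whole observation on to its value; the last rule plays no role.
    | var x => exact decomposes_var x σ L _ ⟨q, by rw [← htp] at hw; exact hw, hq⟩
    | app f ts =>
      have hn : r.IsNtytt := (hF r hr).elim And.left And.left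
      let τ' : V → ClosedTerm S V := fun x => ⟨τ x, hτ x⟩
      obtain ⟨η, hη, hητ⟩ := exists_bind_source_eq (hF r hr) τ' σ f ts
        ((Subtype.ext (hsrc ▸ hp) : r.source.close τ' = p).trans htp.symm)
      rw [← hη] at hL ⊢
      -- Under `σ` and `τ'` the instantiated terms close to the instances in the given proof, so
      -- what is known of those carries over.
      have instantiate_close : ∀ v : Term S V,
          (v.bind (r.instantiate η)).close (Sum.elim σ τ') = v.close τ' := by
        intro v
        rw [Term.close_bind]
        congr 1
        funext z
        unfold Rule.instantiate
        split_ifs with hz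
        · rw [Term.close_bind]
          exact hητ z hz
        · rfl
      refine decomposes_rule hr hn (hΛ r hr) (hP.2 r hr) hc τ' hL
        (fun hl => ih _ _ _ _ _ hφ hl ?_) (fun u b y hu ψ hψ hy hl => ?_)
      · rw [instantiate_close]
        exact (Subtype.ext hq' : t'.close τ' = q) ▸ hq
      · refine ihp _ hu (u.close τ') (τ' y) b ?_ _ _ _ _ _ (hψ.trans hφ) hl (instantiate_close u) hy
        simp only [Literal.subst, Term.subst_eq_bind]
        rfl

theorem decomposes (hP : P.IsPositive) (hF : P.NtyftNtyxtFormat)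
    (hΛ : ∀ r ∈ P.rules, r.FailureTraceSafe Λ) (n : ℕ) :
    ∀ (W : Type v) (t : Term S W) (σ : W → ClosedTerm S V) (L : Set W) (φ : TraceObs A),
      φ.length ≤ n → t.Linear Λ L → P.Sat (t.close σ) φ → P.Decomposes t σ L φ := by
  induction n with
  | zero =>
    intro W t σ L φ hφ _ _
    cases φ with
    | top => exact decomposes_top t σ L
    | act a φ => exact absurd hφ (Nat.not_succ_le_zero _)
  | succ n ih =>
    intro W t σ L φ hφ hL h
    cases φ with
    | top => exact decomposes_top t σ L
    | act a φ =>
      obtain ⟨q, hw, hq⟩ := h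
      exact decomposes_act hP hF hΛ n ih hw _ q a rfl W t σ L φ (Nat.le_of_succ_le_succ hφ) hL
        rfl hq

end TSS

end SOS

/-! ### The precongruence theorem -/

theorem mainTheorem7 {V : Type v} {A : Type w} (S : SOS.Signature.{u}) [Infinite V]
    (hA : Cardinal.lift.{v} (Cardinal.mk A) ≤ Cardinal.lift.{w} (Cardinal.mk V))
    (hS : Cardinal.lift.{v} (Cardinal.mk S.Sym) ≤ Cardinal.lift.{u} (Cardinal.mk V))
    (P : SOS.TSS S V A) (hP : P.PartialTraceFormat) :
    SOS.IsPrecongruence P.TracePreorder := by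
  obtain ⟨hpos, -, hF, Λ, hΛ⟩ := hP
  refine ⟨fun _ _ h => h, fun _ _ _ h h' _ hφ => h' (h hφ), fun f p q hpq φ hφ => ?_⟩
  let t : SOS.Term S (ULift.{v} (Fin (S.ar f))) := .app f fun i => .var ⟨i⟩
  -- With `L = ∅` linearity is vacuous, and the preorder between arguments is all that `h` asks for.
  obtain ⟨θ, -, -, h⟩ := SOS.TSS.decomposes hpos hF hΛ φ.length _ t (fun i => p i.down) ∅ φ le_rfl
    ⟨fun _ h => h.elim, fun _ h => h.elim⟩ hφ
  exact h (fun i => q i.down) (fun _ h => h.elim) fun i _ => hpq i.down
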